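/- Let $Z$ denote a standard Gaussian random vector in $\mathbb{R}^n$. For a nonempty closed convex set $K\subseteq\mathbb{R}^n$ let $P_K$ be the Euclidean projection onto $K$, and for $\mu\in K$ let $R_1(\mu):=\mathbb{E}\|P_K(Z+\mu)-\mu\|^2$ be the risk at $\mu$ of the least squares estimator $P_K(Z+\mu)$. For a Borel measurable map $g:\mathbb{R}^n\to\mathbb{R}^n$ let $R_2(\mu):=\mathbb{E}\|g(Z+\mu)-\mu\|^2\in[0,\infty]$ be the risk at $\mu$ of the estimator $g(Z+\mu)$. There is a universal constant $C>0$ such that, for every $n$, every nonempty closed convex set $K\subseteq\mathbb{R}^n$ and every Borel measurable $g:\mathbb{R}^n\to\mathbb{R}^n$, both of the following hold. 1. There exists $\mu\in K$ with $R_2(\mu)\ge C\,R_1(\mu)$. 2. With the same constant $C$, $$\sup_{\mu\in K}R_2(\mu)\ \ge\ C\,L\,\sup_{\mu\in K}R_1(\mu),\qquad\text{where } L:=\frac{\inf_{\mu\in K}R_1(\mu)}{\sup_{\mu\in K}R_1(\mu)}.$$ (If $K$ is a single point, then $\sup_K R_1=0$ and $L$ is read as $0$.) -/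

import Mathlib

open MeasureTheory ProbabilityTheory
open scoped ENNReal

noncomputable section

/-- `p` is a point of `K` closest to `x` in the Euclidean distance. -/
def IsClosestPoint {n : ℕ} (K : Set (EuclideanSpace ℝ (Fin n)))
    (x p : EuclideanSpace ℝ (Fin n)) : Prop :=
  p ∈ K ∧ ∀ q ∈ K, ‖x - p‖ ≤ ‖x - q‖

open Classical in
/-- The Euclidean projection `P_K` onto `K`: the point of `K` closest to `x`.
For nonempty closed convex `K` such a point exists and is unique, see
`isClosestPoint_euclideanProj` and `IsClosestPoint.eq_euclideanProj`
(the value `0` is a default, never used for such `K`). -/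
def euclideanProj {n : ℕ} (K : Set (EuclideanSpace ℝ (Fin n)))
    (x : EuclideanSpace ℝ (Fin n)) : EuclideanSpace ℝ (Fin n) :=
  if h : ∃ p, IsClosestPoint K x p then h.choose else 0

theorem isClosestPoint_euclideanProj {n : ℕ} {K : Set (EuclideanSpace ℝ (Fin n))}
    (hne : K.Nonempty) (hcl : IsClosed K) (x : EuclideanSpace ℝ (Fin n)) :
    IsClosestPoint K x (euclideanProj K x) := by
  have h : ∃ p, IsClosestPoint K x p := by
    obtain ⟨p, hp, hd⟩ := hcl.exists_infDist_eq_dist hne x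
    refine ⟨p, hp, fun q hq => ?_⟩
    rw [← dist_eq_norm, ← dist_eq_norm, ← hd]
    exact Metric.infDist_le_dist_of_mem hq
  rw [euclideanProj, dif_pos h]
  exact h.choose_spec

theorem IsClosestPoint.eq_euclideanProj {n : ℕ} {K : Set (EuclideanSpace ℝ (Fin n))}
    (hcl : IsClosed K) (hcv : Convex ℝ K) {x p : EuclideanSpace ℝ (Fin n)}
    (hp : IsClosestPoint K x p) : p = euclideanProj K x := by
  have hq := isClosestPoint_euclideanProj ⟨p, hp.1⟩ hcl x
  have key : ∀ r, IsClosestPoint K x r → ∀ w ∈ K, inner ℝ (x - r) (w - r) ≤ 0 := by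
    intro r hr
    have : Nonempty K := ⟨⟨r, hr.1⟩⟩
    refine (norm_eq_iInf_iff_real_inner_le_zero hcv hr.1).1 (le_antisymm ?_ ?_)
    · exact le_ciInf fun w => hr.2 w w.2
    · exact ciInf_le (f := fun w : K => ‖x - w‖)
        ⟨0, Set.forall_mem_range.2 fun _ => norm_nonneg _⟩ ⟨r, hr.1⟩
  have h1 := key p hp _ hq.1
  have h2 := key _ hq p hp.1
  have h3 : inner ℝ (p - euclideanProj K x) (p - euclideanProj K x) ≤ (0 : ℝ) := by
    have e : inner ℝ (p - euclideanProj K x) (p - euclideanProj K x)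
        = inner ℝ (x - p) (euclideanProj K x - p)
          + inner ℝ (x - euclideanProj K x) (p - euclideanProj K x) := by
      rw [← neg_sub p (euclideanProj K x), inner_neg_right, ← sub_eq_neg_add, ← inner_sub_left]
      congr 1
      abel
    linarith
  rw [real_inner_self_eq_norm_sq] at h3
  exact sub_eq_zero.1 (norm_eq_zero.1 (pow_eq_zero_iff two_ne_zero |>.1 (le_antisymm h3 (sq_nonneg _))))

/-- The risk `E ‖g (Z + μ) - μ‖ ^ 2` at `μ`, under square loss, of the estimator `g (Z + μ)`,
where `Z` is a standard Gaussian vector in `ℝⁿ`. It takes values in `[0, ∞]`. -/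
def risk {n : ℕ} (g : EuclideanSpace ℝ (Fin n) → EuclideanSpace ℝ (Fin n))
    (μ : EuclideanSpace ℝ (Fin n)) : ℝ≥0∞ :=
  ∫⁻ z, ‖g (z + μ) - μ‖ₑ ^ 2 ∂(stdGaussian (EuclideanSpace ℝ (Fin n)))

/-- The risk at `μ` of the least squares estimator `P_K (Z + μ)`. -/
def lseRisk {n : ℕ} (K : Set (EuclideanSpace ℝ (Fin n)))
    (μ : EuclideanSpace ℝ (Fin n)) : ℝ≥0∞ :=
  risk (euclideanProj K) μ

/-- The ratio `L = inf_K R₁ / sup_K R₁`, where `R₁` is the risk of the least squares estimator.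
Here `sup_K R₁ ≤ n` is finite; it vanishes only if `K` is a single point, and then `L = 0 / 0 = 0`
(its value plays no role then, as `L` is only multiplied by `sup_K R₁ = 0`). -/
def lseRiskRatio {n : ℕ} (K : Set (EuclideanSpace ℝ (Fin n))) : ℝ≥0∞ :=
  (⨅ μ ∈ K, lseRisk K μ) / (⨆ μ ∈ K, lseRisk K μ)

/-- `C` is a constant for which the least squares estimator is always admissible up to the
factor `C`: in every dimension, for every nonempty closed convex `K` and every Borel
measurable `g`, the risk of `g` is, somewhere on `K`, at least `C` times that of the
least squares estimator. -/
def IsAdmissibilityConstant (C : ℝ) : Prop :=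
  ∀ (n : ℕ) (K : Set (EuclideanSpace ℝ (Fin n))), K.Nonempty → IsClosed K → Convex ℝ K →
    ∀ g : EuclideanSpace ℝ (Fin n) → EuclideanSpace ℝ (Fin n), Measurable g →
      ∃ μ ∈ K, ENNReal.ofReal C * lseRisk K μ ≤ risk g μ

end

noncomputable section

/-! The proof is a Bayesian lower bound at a well-chosen point. Write `u(z)` for `lseError K μ z`,
`R` for its mean square and `G(μ)` for `lseGain K μ`, the mean of the maximum over `p ∈ K` of `⟪Z, p
- μ⟫ - ‖p - μ‖² / 2`. Choose `μ` nearly maximizing `G` on `K`, and let the unknown mean be `μ + r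
u(W)` with `W` Gaussian and independent of the noise; it lies in `K` by convexity for `0 ≤ r ≤ 1`.

If `g` had risk far below that of least squares throughout `K`, then dilating its output about `μ`
by `1/r` and projecting to `K` would give a `K`-valued estimate `f` of `μ + u(W)` with error small
compared to `R`.

This is impossible. For a fixed `ν ∈ K`, the moment bound `lintegral_exp_lseError_le` says that `⟪W,
u(W)⟫` can hardly exceed `G(ν)` while `μ + u(W)` is near `ν`; yet its mean is `G(μ) + R/2`, and
`G(ν)` is at most about `G(μ)`. The data depend on `W`, but Cameron–Martin removes this dependence
at a cost of order `r² R`, so `f` may take the place of `ν` (`lintegral_exp_prior_le_one`). Jensen's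
inequality then gives a linear inequality that fails for small constants.

The moment bound comes from Maurey's property `(τ)`, itself a consequence of Prékopa–Leindler on the
line and tensorization. -/

/-! ### Brunn–Minkowski and Prékopa–Leindler on the line. -/

/-- `C` contains the half-scale copies `(A + min B) / 2` and `(max A + B) / 2`, which meet in at
most one point. -/
theorem volume_add_volume_le_of_midpoint_mem_of_isCompact {A B C : Set ℝ} (hA : IsCompact A)
    (hB : IsCompact B) (hA0 : A.Nonempty) (hB0 : B.Nonempty)
    (h : ∀ a ∈ A, ∀ b ∈ B, (a + b) / 2 ∈ C) : volume A + volume B ≤ 2 * volume C := by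
  obtain ⟨α, hαA, hα⟩ := hA.exists_isGreatest hA0
  obtain ⟨β, hβB, hβ⟩ := hB.exists_isLeast hB0
  have half : ∀ (s : Set ℝ) (c : ℝ), volume s = 2 * volume ((fun x => 2 * x + c) ⁻¹' s) := by
    intro s c
    have e : (fun x : ℝ => 2 * x + c) ⁻¹' s = (fun x => 2 * x) ⁻¹' ((fun x => x + c) ⁻¹' s) := rfl
    rw [e, Real.volume_preimage_mul_left two_ne_zero, measure_preimage_add_right, ← mul_assoc,
      abs_of_pos (by norm_num), ENNReal.ofReal_inv_of_pos two_pos, ENNReal.ofReal_ofNat,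
      ENNReal.mul_inv_cancel (by norm_num) (by norm_num), one_mul]
  have hmeas : MeasurableSet ((fun x : ℝ => 2 * x + -α) ⁻¹' B) :=
    (show Measurable fun x : ℝ => 2 * x + -α by fun_prop) hB.measurableSet
  rw [half A (-β), half B (-α), ← mul_add]
  gcongr
  rw [← measure_union₀ hmeas.nullMeasurableSet]
  · refine measure_mono ?_
    rintro x (hx | hx)
    · have := h _ hx β hβB
      simpa using this
    · have := h α hαA _ hx
      simpa using this
  · refine measure_mono_null (t := {(α + β) / 2}) ?_ (by simp)
    rintro x ⟨h1, h2⟩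
    have h1' := hα h1
    have h2' := hβ h2
    simp only [Set.mem_singleton_iff] at *
    linarith

theorem volume_add_volume_le_of_midpoint_mem {A B C : Set ℝ} (hA : MeasurableSet A)
    (hB : MeasurableSet B) (hA0 : A.Nonempty) (hB0 : B.Nonempty)
    (h : ∀ a ∈ A, ∀ b ∈ B, (a + b) / 2 ∈ C) : volume A + volume B ≤ 2 * volume C := by
  obtain ⟨a, ha⟩ := hA0
  obtain ⟨b, hb⟩ := hB0
  rw [hA.measure_eq_iSup_isCompact, hB.measure_eq_iSup_isCompact]
  simp only [iSup_and']
  refine ENNReal.biSup_add_biSup_le' ⟨∅, by simp⟩ ⟨∅, by simp⟩ ?_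
  rintro K ⟨hKA, hK⟩ L ⟨hLB, hL⟩
  -- The approximating compact sets may be empty; inserting `a` and `b` keeps both nonempty.
  refine le_trans (add_le_add (measure_mono (Set.subset_insert a K))
    (measure_mono (Set.subset_insert b L))) ?_
  refine volume_add_volume_le_of_midpoint_mem_of_isCompact (hK.insert a) (hL.insert b)
    (Set.insert_nonempty _ _) (Set.insert_nonempty _ _) fun x hx y hy => h x ?_ y ?_
  · exact Set.insert_subset ha hKA hx
  · exact Set.insert_subset hb hLB hy

/-- The additive form of the Prékopa–Leindler inequality on the line, for functions with the same
supremum `1`. -/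
theorem lintegral_add_lintegral_le_of_isLUB {u v w : ℝ → ℝ} (hu : Measurable u) (hv : Measurable v)
    (hw : Measurable w) (hu0 : ∀ x, 0 ≤ u x) (hv0 : ∀ x, 0 ≤ v x) (hw0 : ∀ x, 0 ≤ w x)
    (hu1 : IsLUB (Set.range u) 1) (hv1 : IsLUB (Set.range v) 1)
    (h : ∀ x y, u x * v y ≤ w ((x + y) / 2) ^ 2) :
    (∫⁻ x, ENNReal.ofReal (u x)) + ∫⁻ x, ENNReal.ofReal (v x)
      ≤ 2 * ∫⁻ x, ENNReal.ofReal (w x) := by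
  have cake : ∀ f : ℝ → ℝ, Measurable f → (∀ x, 0 ≤ f x) →
      ∫⁻ x, ENNReal.ofReal (f x) = ∫⁻ t in Set.Ioi 0, volume {x | t < f x} := fun f hf h0 =>
    lintegral_eq_lintegral_meas_lt _ (Filter.Eventually.of_forall h0) hf.aemeasurable
  have anti : ∀ f : ℝ → ℝ, Measurable fun t => volume {x | t < f x} := fun f =>
    Antitone.measurable fun s t hst => measure_mono fun x hx => lt_of_le_of_lt hst hx
  rw [cake u hu hu0, cake v hv hv0, cake w hw hw0, ← lintegral_add_left (anti u),
    ← lintegral_const_mul _ (anti w)]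
  refine setLIntegral_mono ((anti w).const_mul 2) fun t ht => ?_
  -- The common supremum matters here: below level `1` both superlevel sets are nonempty, so the
  -- inequality for sets applies, and from level `1` on both are empty.
  rcases lt_or_ge t 1 with ht1 | ht1
  · obtain ⟨_, ⟨a, rfl⟩, ha, -⟩ := hu1.exists_between ht1
    obtain ⟨_, ⟨b, rfl⟩, hb, -⟩ := hv1.exists_between ht1
    refine volume_add_volume_le_of_midpoint_mem (measurableSet_lt measurable_const hu)
      (measurableSet_lt measurable_const hv) ⟨a, ha⟩ ⟨b, hb⟩ fun x hx y hy => ?_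
    have ht0 : (0 : ℝ) < t := ht
    have hx' : t < u x := hx
    have hy' : t < v y := hy
    refine lt_of_pow_lt_pow_left₀ 2 (hw0 _) (lt_of_lt_of_le ?_ (h x y))
    rw [sq]
    exact mul_lt_mul'' hx' hy' ht0.le ht0.le
  · have e : ∀ f : ℝ → ℝ, IsLUB (Set.range f) 1 → {x | t < f x} = ∅ := fun f hf =>
      Set.eq_empty_iff_forall_notMem.2 fun x hx =>
        absurd (hf.1 ⟨x, rfl⟩) (not_le.2 (lt_of_le_of_lt ht1 hx))
    rw [e u hu1, e v hv1]
    simp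

theorem ENNReal.four_mul_le_sq_add (a b : ℝ≥0∞) : 4 * (a * b) ≤ (a + b) ^ 2 := by
  rcases eq_or_ne a ∞ with rfl | ha
  · simp
  rcases eq_or_ne b ∞ with rfl | hb
  · simp
  lift a to NNReal using ha
  lift b to NNReal using hb
  norm_cast
  rw [← NNReal.coe_le_coe]
  push_cast
  nlinarith [sq_nonneg ((a : ℝ) - b)]

/-- The Prékopa–Leindler inequality on the line, for bounded functions. -/
theorem lintegral_mul_lintegral_le_sq_of_bounded {u v w : ℝ → ℝ} (hu : Measurable u)
    (hv : Measurable v) (hw : Measurable w) (hu0 : ∀ x, 0 ≤ u x) (hv0 : ∀ x, 0 ≤ v x)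
    (hw0 : ∀ x, 0 ≤ w x) (hub : BddAbove (Set.range u)) (hvb : BddAbove (Set.range v))
    (h : ∀ x y, u x * v y ≤ w ((x + y) / 2) ^ 2) :
    (∫⁻ x, ENNReal.ofReal (u x)) * ∫⁻ x, ENNReal.ofReal (v x)
      ≤ (∫⁻ x, ENNReal.ofReal (w x)) ^ 2 := by
  set A := sSup (Set.range u) with hA
  set B := sSup (Set.range v) with hB
  have lubA : IsLUB (Set.range u) A := isLUB_csSup (Set.range_nonempty u) hub
  have lubB : IsLUB (Set.range v) B := isLUB_csSup (Set.range_nonempty v) hvb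
  have hA0 : 0 ≤ A := (hu0 0).trans (lubA.1 ⟨0, rfl⟩)
  have hB0 : 0 ≤ B := (hv0 0).trans (lubB.1 ⟨0, rfl⟩)
  have vanish : ∀ f : ℝ → ℝ, IsLUB (Set.range f) 0 → ∫⁻ x, ENNReal.ofReal (f x) = 0 := by
    intro f hf
    simp [fun x => ENNReal.ofReal_of_nonpos (hf.1 ⟨x, rfl⟩)]
  rcases hA0.eq_or_lt with hA' | hA'
  · rw [← hA'] at lubA
    simp [vanish u lubA]
  rcases hB0.eq_or_lt with hB' | hB'
  · rw [← hB'] at lubB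
    simp [vanish v lubB]
  have lub_div : ∀ (f : ℝ → ℝ) (M : ℝ), 0 < M → IsLUB (Set.range f) M →
      IsLUB (Set.range fun x => f x / M) 1 := by
    intro f M hM hf
    refine ⟨?_, fun c hc => ?_⟩
    · rintro _ ⟨x, rfl⟩
      exact (div_le_one hM).2 (hf.1 ⟨x, rfl⟩)
    · have : M ≤ c * M := hf.2 (by
        rintro _ ⟨x, rfl⟩
        exact (div_le_iff₀ hM).1 (hc ⟨x, rfl⟩))
      nlinarith
  have hs : 0 < √(A * B) := Real.sqrt_pos.2 (mul_pos hA' hB')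
  have key := lintegral_add_lintegral_le_of_isLUB (hu.div_const A) (hv.div_const B)
    (hw.div_const √(A * B)) (fun x => div_nonneg (hu0 x) hA0) (fun x => div_nonneg (hv0 x) hB0)
    (fun x => div_nonneg (hw0 x) hs.le) (lub_div u A hA' lubA) (lub_div v B hB' lubB) (by
      intro x y
      rw [div_mul_div_comm, div_pow, Real.sq_sqrt (mul_pos hA' hB').le]
      exact div_le_div_of_nonneg_right (h x y) (mul_pos hA' hB').le)
  have pull : ∀ (f : ℝ → ℝ) (M : ℝ), 0 < M → Measurable f →
      ∫⁻ x, ENNReal.ofReal (f x / M) = (∫⁻ x, ENNReal.ofReal (f x)) * (ENNReal.ofReal M)⁻¹ := by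
    intro f M hM hf
    rw [← lintegral_mul_const _ hf.ennreal_ofReal]
    simp_rw [ENNReal.ofReal_div_of_pos hM, div_eq_mul_inv]
  rw [pull u A hA' hu, pull v B hB' hv, pull w _ hs hw] at key
  -- After normalization of the suprema, AM–GM turns the additive inequality into the multiplicative
  -- one.
  have k2 := (ENNReal.four_mul_le_sq_add _ _).trans (pow_le_pow_left' key 2)
  set U := ∫⁻ x, ENNReal.ofReal (u x)
  set V := ∫⁻ x, ENNReal.ofReal (v x)
  set W := ∫⁻ x, ENNReal.ofReal (w x)
  have hAt : ENNReal.ofReal A ≠ 0 := by simpa using hA'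
  have hBt : ENNReal.ofReal B ≠ 0 := by simpa using hB'
  have e : (ENNReal.ofReal √(A * B))⁻¹ ^ 2 = (ENNReal.ofReal A)⁻¹ * (ENNReal.ofReal B)⁻¹ := by
    rw [← ENNReal.inv_pow, ← ENNReal.ofReal_pow hs.le, Real.sq_sqrt (mul_pos hA' hB').le,
      ENNReal.ofReal_mul hA0, ENNReal.mul_inv (Or.inl hAt) (Or.inr hBt)]
  set c := (ENNReal.ofReal A)⁻¹ * (ENNReal.ofReal B)⁻¹ with hc
  have k3 : (4 * c) * (U * V) ≤ (4 * c) * W ^ 2 := by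
    calc (4 * c) * (U * V) = 4 * (U * (ENNReal.ofReal A)⁻¹ * (V * (ENNReal.ofReal B)⁻¹)) := by
          rw [hc]; ring
      _ ≤ (2 * (W * (ENNReal.ofReal √(A * B))⁻¹)) ^ 2 := k2
      _ = (4 * c) * W ^ 2 := by rw [mul_pow, mul_pow, e]; ring
  have hc0 : c ≠ 0 := by simp [hc]
  have hct : c ≠ ∞ := ENNReal.mul_ne_top (by simpa using hA') (by simpa using hB')
  exact (ENNReal.mul_le_mul_iff_right (mul_ne_zero four_ne_zero hc0)
    (ENNReal.mul_ne_top (by norm_num) hct)).1 k3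

/-! ### Property `(τ)` for Gaussian measures. -/

theorem lintegral_iSup_min_natCast {α : Type*} [MeasurableSpace α] (m : Measure α) {f : α → ℝ≥0∞}
    (hf : Measurable f) : ∫⁻ x, f x ∂m = ⨆ k : ℕ, ∫⁻ x, min (f x) k ∂m := by
  rw [← lintegral_iSup (fun k => hf.min measurable_const)]
  · refine lintegral_congr fun x => ?_
    have := inf_iSup_eq (f x) (fun k : ℕ => (k : ℝ≥0∞))
    rw [ENNReal.iSup_natCast, inf_top_eq] at this
    exact this
  · intro i j hij x
    exact min_le_min_left _ (by exact_mod_cast hij)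

theorem lintegral_gaussianReal_zero_one {f : ℝ → ℝ≥0∞} (hf : Measurable f) :
    ∫⁻ x, f x ∂(gaussianReal 0 1) = ∫⁻ x, f x * gaussianPDF 0 1 x := by
  rw [gaussianReal_of_var_ne_zero _ one_ne_zero,
    lintegral_withDensity_eq_lintegral_mul _ (measurable_gaussianPDF 0 1) hf]
  simp [mul_comm]

theorem gaussianPDFReal_zero_one (x : ℝ) :
    gaussianPDFReal 0 1 x = (√(2 * Real.pi))⁻¹ * Real.exp (-x ^ 2 / 2) := by
  simp [gaussianPDFReal]

/-- Maurey's property `(τ)` of the measure `m` for the cost `c`. -/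
def PropertyTau {α : Type*} [MeasurableSpace α] (m : Measure α) (c : α → α → ℝ) : Prop :=
  ∀ a b : α → ℝ≥0∞, Measurable a → Measurable b →
    (∀ x y, a x * b y ≤ ENNReal.ofReal (Real.exp (c x y))) → (∫⁻ x, a x ∂m) * ∫⁻ y, b y ∂m ≤ 1

/-- Prékopa–Leindler for `a p`, `b p` and the density `p`: the cost is exactly what makes `exp ((x -
y)² / 4) p(x) p(y) = p((x + y) / 2)²`. Truncating `a` and `b` supplies boundedness. -/
theorem propertyTau_gaussianReal : PropertyTau (gaussianReal 0 1) fun x y => (x - y) ^ 2 / 4 := by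
  intro a b ha hb h
  rw [lintegral_iSup_min_natCast _ ha, lintegral_iSup_min_natCast _ hb, ENNReal.iSup_mul]
  refine iSup_le fun i => ?_
  rw [ENNReal.mul_iSup]
  refine iSup_le fun j => ?_
  have fin : ∀ (f : ℝ → ℝ≥0∞) (k : ℕ) (x : ℝ), min (f x) k ≠ ∞ := fun f k x =>
    ne_top_of_le_ne_top (ENNReal.natCast_ne_top k) (min_le_right _ _)
  set p := gaussianPDFReal 0 1
  have hp0 : ∀ x, 0 ≤ p x := gaussianPDFReal_nonneg 0 1
  have hpm : Measurable p := measurable_gaussianPDFReal 0 1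
  have conv : ∀ (f : ℝ → ℝ≥0∞) (k : ℕ), Measurable f →
      ∫⁻ x, min (f x) k ∂(gaussianReal 0 1)
        = ∫⁻ x, ENNReal.ofReal ((min (f x) k).toReal * p x) := by
    intro f k hf
    rw [lintegral_gaussianReal_zero_one (hf.min measurable_const)]
    refine lintegral_congr fun x => ?_
    rw [ENNReal.ofReal_mul ENNReal.toReal_nonneg, ENNReal.ofReal_toReal (fin f k x)]
    rfl
  have bdd : ∀ (f : ℝ → ℝ≥0∞) (k : ℕ),
      BddAbove (Set.range fun x => (min (f x) k).toReal * p x) := by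
    intro f k
    refine ⟨k * (√(2 * Real.pi))⁻¹, ?_⟩
    rintro _ ⟨x, rfl⟩
    have h1 : (min (f x) k).toReal ≤ k := by
      have := ENNReal.toReal_mono (ENNReal.natCast_ne_top k) (min_le_right (f x) (k : ℝ≥0∞))
      simpa using this
    have h2 : p x ≤ (√(2 * Real.pi))⁻¹ := by
      rw [show p x = _ from gaussianPDFReal_zero_one x]
      refine mul_le_of_le_one_right (by positivity) (Real.exp_le_one_iff.2 ?_)
      nlinarith [sq_nonneg x]
    exact mul_le_mul h1 h2 (hp0 x) (Nat.cast_nonneg k)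
  rw [conv a i ha, conv b j hb]
  refine (lintegral_mul_lintegral_le_sq_of_bounded (w := p)
    ((ha.min measurable_const).ennreal_toReal.mul hpm)
    ((hb.min measurable_const).ennreal_toReal.mul hpm) hpm
    (fun x => mul_nonneg ENNReal.toReal_nonneg (hp0 x))
    (fun x => mul_nonneg ENNReal.toReal_nonneg (hp0 x)) hp0 (bdd a i) (bdd b j) ?_).trans ?_
  · intro x y
    have h1 : (min (a x) i).toReal * (min (b y) j).toReal ≤ Real.exp ((x - y) ^ 2 / 4) := by
      rw [← ENNReal.toReal_mul]
      refine ENNReal.toReal_le_of_le_ofReal (Real.exp_pos _).le ((h x y).trans' ?_)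
      exact mul_le_mul' (min_le_left _ _) (min_le_left _ _)
    have h2 : Real.exp ((x - y) ^ 2 / 4) * (p x * p y) = p ((x + y) / 2) ^ 2 := by
      simp only [p, gaussianPDFReal_zero_one]
      rw [mul_pow, ← Real.exp_nat_mul, mul_mul_mul_comm, ← Real.exp_add, mul_left_comm,
        ← Real.exp_add, ← sq]
      congr 2
      push_cast
      ring
    calc (min (a x) i).toReal * p x * ((min (b y) j).toReal * p y)
        = (min (a x) i).toReal * (min (b y) j).toReal * (p x * p y) := by ring
      _ ≤ Real.exp ((x - y) ^ 2 / 4) * (p x * p y) :=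
          mul_le_mul_of_nonneg_right h1 (mul_nonneg (hp0 x) (hp0 y))
      _ = _ := h2
  · have : ∫⁻ x, ENNReal.ofReal (p x) = 1 := lintegral_gaussianPDF_eq_one 0 one_ne_zero
    rw [this, one_pow]

/-- For fixed first coordinates, the second property applies to the fibres once `exp (c x y)` is
divided out; the fibre integrals then satisfy the hypothesis of the first. -/
theorem PropertyTau.prod {α β : Type*} [MeasurableSpace α] [MeasurableSpace β] {m : Measure α}
    {m' : Measure β} [SFinite m] [SFinite m'] {c : α → α → ℝ} {c' : β → β → ℝ}
    (h : PropertyTau m c) (h' : PropertyTau m' c') :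
    PropertyTau (m.prod m') fun x y => c x.1 y.1 + c' x.2 y.2 := by
  intro a b ha hb hab
  rw [lintegral_prod _ ha.aemeasurable, lintegral_prod _ hb.aemeasurable]
  refine h _ _ ha.lintegral_prod_right' hb.lintegral_prod_right' fun x y => ?_
  set e := ENNReal.ofReal (Real.exp (c x y)) with he
  have he0 : e ≠ 0 := by simpa [he] using Real.exp_pos _
  have het : e ≠ ∞ := ENNReal.ofReal_ne_top
  have hax : Measurable fun s => a (x, s) := ha.comp measurable_prodMk_left
  have key := h' (fun s => e⁻¹ * a (x, s)) (fun t => b (y, t))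
    (hax.const_mul _) (hb.comp measurable_prodMk_left) (by
      intro s t
      rw [mul_assoc, ENNReal.inv_mul_le_iff he0 het, he, ← ENNReal.ofReal_mul (Real.exp_pos _).le,
        ← Real.exp_add]
      exact hab (x, s) (y, t))
  rw [lintegral_const_mul _ hax, mul_assoc,
    ENNReal.inv_mul_le_iff he0 het, mul_one] at key
  exact key

theorem propertyTau_pi_gaussianReal (n : ℕ) :
    PropertyTau (Measure.pi fun _ : Fin n => gaussianReal 0 1)
      fun x y => ∑ i, (x i - y i) ^ 2 / 4 := by
  induction n with
  | zero =>
    intro a b _ _ h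
    simpa [Measure.pi_of_empty _ (0 : Fin 0 → ℝ)] using h 0 0
  | succ n ih =>
    intro a b ha hb h
    have mp := (measurePreserving_piFinSuccAbove (fun _ : Fin (n + 1) => gaussianReal 0 1) 0).symm
    rw [← mp.lintegral_comp ha, ← mp.lintegral_comp hb]
    refine propertyTau_gaussianReal.prod ih _ _ (ha.comp mp.measurable) (hb.comp mp.measurable)
      fun x y => (h _ _).trans (le_of_eq ?_)
    simp [Fin.sum_univ_succ, MeasurableEquiv.piFinSuccAbove_symm_apply, Fin.insertNthEquiv]

/-! ### Cameron–Martin, and passage to `stdGaussian`. -/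

/-- Gaussian integration is tilted by translations, on the line. -/
theorem lintegral_add_mul_exp_gaussianReal {f : ℝ → ℝ≥0∞} (hf : Measurable f) (v : ℝ) :
    ∫⁻ x, f (x + v) * ENNReal.ofReal (Real.exp (-(x * v) - v ^ 2 / 2)) ∂(gaussianReal 0 1)
      = ∫⁻ x, f x ∂(gaussianReal 0 1) := by
  rw [lintegral_gaussianReal_zero_one (by fun_prop), lintegral_gaussianReal_zero_one hf,
    ← lintegral_add_right_eq_self (fun x => f x * gaussianPDF 0 1 x) v]
  refine lintegral_congr fun x => ?_
  rw [mul_assoc]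
  congr 1
  rw [gaussianPDF, gaussianPDF, ← ENNReal.ofReal_mul (Real.exp_pos _).le,
    gaussianPDFReal_zero_one, gaussianPDFReal_zero_one, mul_left_comm, ← Real.exp_add]
  congr 3
  ring

theorem lintegral_add_mul_exp_pi_gaussianReal (n : ℕ) {f : (Fin n → ℝ) → ℝ≥0∞} (hf : Measurable f)
    (v : Fin n → ℝ) :
    ∫⁻ x, f (x + v) * ENNReal.ofReal (Real.exp (∑ i, (-(x i * v i) - v i ^ 2 / 2)))
        ∂(Measure.pi fun _ => gaussianReal 0 1)
      = ∫⁻ x, f x ∂(Measure.pi fun _ => gaussianReal 0 1) := by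
  induction n with
  | zero => simp [Measure.pi_of_empty _ (0 : Fin 0 → ℝ), lintegral_dirac' _ hf]
  | succ n ih =>
    have mp := (measurePreserving_piFinSuccAbove (fun _ : Fin (n + 1) => gaussianReal 0 1) 0).symm
    have hcons : Measurable fun p : ℝ × (Fin n → ℝ) => (Fin.cons p.1 p.2 : Fin (n + 1) → ℝ) := by
      have := mp.measurable
      simpa [MeasurableEquiv.piFinSuccAbove_symm_apply, Fin.insertNthEquiv] using this
    have hfc : Measurable fun p : ℝ × (Fin n → ℝ) => f (Fin.cons p.1 p.2) := hf.comp hcons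
    have red : ∀ F : (Fin (n + 1) → ℝ) → ℝ≥0∞, Measurable F →
        ∫⁻ x, F x ∂(Measure.pi fun _ => gaussianReal 0 1) = ∫⁻ s, ∫⁻ t, F (Fin.cons s t)
          ∂(Measure.pi fun _ => gaussianReal 0 1) ∂(gaussianReal 0 1) := by
      intro F hF
      have hF' : Measurable fun p => F ((MeasurableEquiv.piFinSuccAbove (fun _ => ℝ) 0).symm p) :=
        hF.comp mp.measurable
      rw [← mp.lintegral_comp hF, lintegral_prod _ hF'.aemeasurable]
      simp [MeasurableEquiv.piFinSuccAbove_symm_apply, Fin.insertNthEquiv]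
    rw [red f hf, red _ (by fun_prop)]
    have hadd : ∀ s t, (Fin.cons s t : Fin (n + 1) → ℝ) + v
        = Fin.cons (s + v 0) (t + fun i => v i.succ) := by
      intro s t
      ext i
      refine Fin.cases ?_ (fun j => ?_) i <;> simp
    rw [← lintegral_add_mul_exp_gaussianReal hfc.lintegral_prod_right' (v 0)]
    refine lintegral_congr fun s => ?_
    have hfs : Measurable fun t : Fin n → ℝ => f (Fin.cons (s + v 0) t) :=
      hfc.comp measurable_prodMk_left
    rw [← ih hfs (fun i => v i.succ), ← lintegral_mul_const]
    · refine lintegral_congr fun t => ?_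
      rw [hadd, Fin.sum_univ_succ, Real.exp_add, ENNReal.ofReal_mul (Real.exp_pos _).le]
      simp only [Fin.cons_zero, Fin.cons_succ]
      ring
    · have : Measurable fun t : Fin n → ℝ => f (Fin.cons (s + v 0) (t + fun i => v i.succ)) :=
        hfs.comp (measurable_id.add_const _)
      fun_prop

variable {n : ℕ}

theorem lintegral_stdGaussian_eq_pi {f : EuclideanSpace ℝ (Fin n) → ℝ≥0∞} (hf : Measurable f) :
    ∫⁻ z, f z ∂(stdGaussian (EuclideanSpace ℝ (Fin n)))
      = ∫⁻ x, f (WithLp.toLp 2 x) ∂(Measure.pi fun _ : Fin n => gaussianReal 0 1) := by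
  rw [← map_pi_eq_stdGaussian, lintegral_map hf (by fun_prop)]

theorem propertyTau_stdGaussian :
    PropertyTau (stdGaussian (EuclideanSpace ℝ (Fin n))) fun x y => ‖x - y‖ ^ 2 / 4 := by
  intro a b ha hb h
  rw [lintegral_stdGaussian_eq_pi ha, lintegral_stdGaussian_eq_pi hb]
  refine propertyTau_pi_gaussianReal n _ _ (by fun_prop) (by fun_prop) fun x y =>
    (h _ _).trans (le_of_eq ?_)
  simp [EuclideanSpace.real_norm_sq_eq, Finset.sum_div]

/-- The Cameron–Martin formula for the standard Gaussian measure. -/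
theorem lintegral_add_mul_exp_stdGaussian {f : EuclideanSpace ℝ (Fin n) → ℝ≥0∞} (hf : Measurable f)
    (v : EuclideanSpace ℝ (Fin n)) :
    ∫⁻ z, f (z + v) * ENNReal.ofReal (Real.exp (-inner ℝ z v - ‖v‖ ^ 2 / 2))
        ∂(stdGaussian (EuclideanSpace ℝ (Fin n)))
      = ∫⁻ z, f z ∂(stdGaussian (EuclideanSpace ℝ (Fin n))) := by
  rw [lintegral_stdGaussian_eq_pi hf, lintegral_stdGaussian_eq_pi (by fun_prop),
    ← lintegral_add_mul_exp_pi_gaussianReal n (f := fun x => f (WithLp.toLp 2 x)) (by fun_prop) v]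
  refine lintegral_congr fun x => ?_
  rw [EuclideanSpace.real_norm_sq_eq]
  simp [PiLp.inner_apply, Finset.sum_sub_distrib, Finset.sum_div, mul_comm]
  exact mul_comm _ _

/-! ### Jensen's inequality for the exponential. -/

section Jensen

variable {α : Type*} [MeasurableSpace α] {m : Measure α}

theorem ofReal_integral_le_lintegral_ofReal {f : α → ℝ} (hf : Integrable f m) :
    ENNReal.ofReal (∫ x, f x ∂m) ≤ ∫⁻ x, ENNReal.ofReal (f x) ∂m := by
  rw [integral_eq_lintegral_pos_part_sub_lintegral_neg_part hf]
  exact (ENNReal.ofReal_le_ofReal (sub_le_self _ ENNReal.toReal_nonneg)).trans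
    ENNReal.ofReal_toReal_le

/-- Integrate the tangent line of `exp` at the mean. With a lower integral on the right, `exp ∘ f`
need not be integrable. -/
theorem ofReal_exp_integral_le_lintegral [IsProbabilityMeasure m] {f : α → ℝ}
    (hf : Integrable f m) :
    ENNReal.ofReal (Real.exp (∫ x, f x ∂m)) ≤ ∫⁻ x, ENNReal.ofReal (Real.exp (f x)) ∂m := by
  set c := ∫ x, f x ∂m with hc
  have hint : Integrable (fun x => Real.exp c * (f x + (1 - c))) m :=
    (hf.add (integrable_const _)).const_mul _
  have e : ∫ x, Real.exp c * (f x + (1 - c)) ∂m = Real.exp c := by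
    rw [integral_const_mul, integral_add hf (integrable_const _), ← hc]
    simp
  rw [← e]
  refine (ofReal_integral_le_lintegral_ofReal hint).trans
    (lintegral_mono fun x => ENNReal.ofReal_le_ofReal ?_)
  have h1 := Real.add_one_le_exp (f x - c)
  have h2 : Real.exp (f x) = Real.exp c * Real.exp (f x - c) := by
    rw [← Real.exp_add]; congr 1; ring
  rw [h2]
  exact mul_le_mul_of_nonneg_left (by linarith) (Real.exp_pos c).le

theorem integral_nonpos_of_lintegral_exp_le_one [IsProbabilityMeasure m] {f : α → ℝ}
    (hf : Integrable f m) (h : ∫⁻ x, ENNReal.ofReal (Real.exp (f x)) ∂m ≤ 1) :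
    ∫ x, f x ∂m ≤ 0 := by
  have := (ofReal_exp_integral_le_lintegral hf).trans h
  rw [ENNReal.ofReal_le_one] at this
  exact Real.exp_le_one_iff.1 this

end Jensen

/-! ### Projections and the least squares error. -/

section Projection

variable {K : Set (EuclideanSpace ℝ (Fin n))}

theorem euclideanProj_mem (hne : K.Nonempty) (hcl : IsClosed K) (x : EuclideanSpace ℝ (Fin n)) :
    euclideanProj K x ∈ K :=
  (isClosestPoint_euclideanProj hne hcl x).1

theorem inner_sub_euclideanProj_le_zero (hcl : IsClosed K) (hcv : Convex ℝ K)
    (x : EuclideanSpace ℝ (Fin n)) {w : EuclideanSpace ℝ (Fin n)} (hw : w ∈ K) :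
    inner ℝ (x - euclideanProj K x) (w - euclideanProj K x) ≤ 0 := by
  have hr := isClosestPoint_euclideanProj ⟨w, hw⟩ hcl x
  have : Nonempty K := ⟨⟨w, hw⟩⟩
  refine (norm_eq_iInf_iff_real_inner_le_zero hcv hr.1).1 (le_antisymm ?_ ?_) w hw
  · exact le_ciInf fun w => hr.2 w w.2
  · exact ciInf_le (f := fun w : K => ‖x - w‖)
      ⟨0, Set.forall_mem_range.2 fun _ => norm_nonneg _⟩ ⟨_, hr.1⟩

/-- Firm nonexpansiveness: add the variational inequalities at the two projections. Both the
projection and its residual are therefore `1`-Lipschitz. -/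
theorem norm_sq_euclideanProj_sub_le_inner (hne : K.Nonempty) (hcl : IsClosed K)
    (hcv : Convex ℝ K) (x y : EuclideanSpace ℝ (Fin n)) :
    ‖euclideanProj K x - euclideanProj K y‖ ^ 2
      ≤ inner ℝ (x - y) (euclideanProj K x - euclideanProj K y) := by
  have h1 := inner_sub_euclideanProj_le_zero hcl hcv x (euclideanProj_mem hne hcl y)
  have h2 := inner_sub_euclideanProj_le_zero hcl hcv y (euclideanProj_mem hne hcl x)
  rw [← real_inner_self_eq_norm_sq]
  simp only [inner_sub_left, inner_sub_right] at *
  linarith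

theorem norm_euclideanProj_sub_le (hne : K.Nonempty) (hcl : IsClosed K) (hcv : Convex ℝ K)
    (x y : EuclideanSpace ℝ (Fin n)) :
    ‖euclideanProj K x - euclideanProj K y‖ ≤ ‖x - y‖ := by
  have h := (norm_sq_euclideanProj_sub_le_inner hne hcl hcv x y).trans (real_inner_le_norm _ _)
  nlinarith [norm_nonneg (x - y), norm_nonneg (euclideanProj K x - euclideanProj K y)]

theorem norm_sub_euclideanProj_sub_le (hne : K.Nonempty) (hcl : IsClosed K) (hcv : Convex ℝ K)
    (x y : EuclideanSpace ℝ (Fin n)) :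
    ‖(x - euclideanProj K x) - (y - euclideanProj K y)‖ ≤ ‖x - y‖ := by
  have h := norm_sq_euclideanProj_sub_le_inner hne hcl hcv x y
  have e : (x - euclideanProj K x) - (y - euclideanProj K y)
      = (x - y) - (euclideanProj K x - euclideanProj K y) := by abel
  refine (pow_le_pow_iff_left₀ (norm_nonneg _) (norm_nonneg _) two_ne_zero).1 ?_
  rw [e, norm_sub_sq_real]
  nlinarith [sq_nonneg ‖euclideanProj K x - euclideanProj K y‖]

theorem continuous_euclideanProj (hne : K.Nonempty) (hcl : IsClosed K) (hcv : Convex ℝ K) :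
    Continuous (euclideanProj K) := by
  refine (LipschitzWith.of_dist_le_mul (K := 1) fun x y => ?_).continuous
  rw [dist_eq_norm, dist_eq_norm, NNReal.coe_one, one_mul]
  exact norm_euclideanProj_sub_le hne hcl hcv x y

theorem euclideanProj_eq_self {x : EuclideanSpace ℝ (Fin n)} (hcl : IsClosed K)
    (hcv : Convex ℝ K) (hx : x ∈ K) : euclideanProj K x = x :=
  (IsClosestPoint.eq_euclideanProj hcl hcv ⟨hx, fun q _ => by simp⟩).symm

/-- The error `P_K (z + μ) - μ` of the least squares estimator at `μ`. -/
def lseError (K : Set (EuclideanSpace ℝ (Fin n))) (μ z : EuclideanSpace ℝ (Fin n)) :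
    EuclideanSpace ℝ (Fin n) :=
  euclideanProj K (z + μ) - μ

theorem continuous_lseError (hne : K.Nonempty) (hcl : IsClosed K) (hcv : Convex ℝ K)
    (μ : EuclideanSpace ℝ (Fin n)) : Continuous (lseError K μ) :=
  ((continuous_euclideanProj hne hcl hcv).comp (continuous_add_const μ)).sub continuous_const

theorem lseError_add_mem (hne : K.Nonempty) (hcl : IsClosed K) (μ z : EuclideanSpace ℝ (Fin n)) :
    lseError K μ z + μ ∈ K := by
  simpa [lseError] using euclideanProj_mem hne hcl (z + μ)

theorem lseError_eq_self (hcl : IsClosed K) (hcv : Convex ℝ K) {μ v : EuclideanSpace ℝ (Fin n)}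
    (h : v + μ ∈ K) : lseError K μ v = v := by
  simp [lseError, euclideanProj_eq_self hcl hcv h]

theorem norm_lseError_sub_le (hne : K.Nonempty) (hcl : IsClosed K) (hcv : Convex ℝ K)
    (μ z z' : EuclideanSpace ℝ (Fin n)) : ‖lseError K μ z - lseError K μ z'‖ ≤ ‖z - z'‖ := by
  simpa [lseError] using norm_euclideanProj_sub_le hne hcl hcv (z + μ) (z' + μ)

theorem norm_lseError_le (hcl : IsClosed K) (hcv : Convex ℝ K) {μ : EuclideanSpace ℝ (Fin n)}
    (hμ : μ ∈ K) (z : EuclideanSpace ℝ (Fin n)) : ‖lseError K μ z‖ ≤ ‖z‖ := by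
  have := norm_lseError_sub_le ⟨μ, hμ⟩ hcl hcv μ z 0
  rwa [lseError_eq_self hcl hcv (v := 0) (by simpa using hμ), sub_zero, sub_zero] at this

/-- The error is `z` minus the residual at `z + μ`, and residuals are nonexpansive. -/
theorem norm_lseError_sub_lseError_le (hne : K.Nonempty) (hcl : IsClosed K) (hcv : Convex ℝ K)
    (μ ν z : EuclideanSpace ℝ (Fin n)) : ‖lseError K μ z - lseError K ν z‖ ≤ ‖μ - ν‖ := by
  have := norm_sub_euclideanProj_sub_le hne hcl hcv (z + ν) (z + μ)
  rw [norm_sub_rev μ ν]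
  have e : lseError K μ z - lseError K ν z
      = (z + ν - euclideanProj K (z + ν)) - (z + μ - euclideanProj K (z + μ)) := by
    simp only [lseError]; abel
  rwa [e, ← add_sub_add_left_eq_sub ν μ z]

end Projection

/-! ### Integrability, risk and gain. -/

section Integrals

theorem integrable_norm_sq_stdGaussian :
    Integrable (fun z => ‖z‖ ^ 2) (stdGaussian (EuclideanSpace ℝ (Fin n))) :=
  (IsGaussian.memLp_two_id (μ := stdGaussian (EuclideanSpace ℝ (Fin n)))).integrable_norm_pow
    two_ne_zero

variable {K : Set (EuclideanSpace ℝ (Fin n))}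

theorem integrable_norm_sq_lseError (hcl : IsClosed K) (hcv : Convex ℝ K)
    {μ : EuclideanSpace ℝ (Fin n)} (hμ : μ ∈ K) :
    Integrable (fun z => ‖lseError K μ z‖ ^ 2) (stdGaussian (EuclideanSpace ℝ (Fin n))) := by
  have := continuous_lseError ⟨μ, hμ⟩ hcl hcv μ
  refine integrable_norm_sq_stdGaussian.mono (by fun_prop) (Filter.Eventually.of_forall fun z => ?_)
  simpa using pow_le_pow_left₀ (norm_nonneg _) (norm_lseError_le hcl hcv hμ z) 2

theorem integrable_inner_lseError (hcl : IsClosed K) (hcv : Convex ℝ K)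
    {μ : EuclideanSpace ℝ (Fin n)} (hμ : μ ∈ K) :
    Integrable (fun z => inner ℝ z (lseError K μ z))
      (stdGaussian (EuclideanSpace ℝ (Fin n))) := by
  have := continuous_lseError ⟨μ, hμ⟩ hcl hcv μ
  refine integrable_norm_sq_stdGaussian.mono (by fun_prop) (Filter.Eventually.of_forall fun z => ?_)
  rw [Real.norm_eq_abs, norm_pow, norm_norm, sq]
  exact (abs_real_inner_le_norm _ _).trans
    (mul_le_mul_of_nonneg_left (norm_lseError_le hcl hcv hμ z) (norm_nonneg z))

theorem integral_inner_const_stdGaussian (v : EuclideanSpace ℝ (Fin n)) :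
    ∫ z, inner ℝ z v ∂(stdGaussian (EuclideanSpace ℝ (Fin n))) = 0 := by
  have h := integral_inner (𝕜 := ℝ) (μ := stdGaussian (EuclideanSpace ℝ (Fin n)))
    (f := fun z => z) IsGaussian.integrable_id v
  simp_rw [real_inner_comm]
  rw [h, integral_id_stdGaussian, inner_zero_right]

theorem integrable_inner_const_stdGaussian (v : EuclideanSpace ℝ (Fin n)) :
    Integrable (fun z => inner ℝ z v) (stdGaussian (EuclideanSpace ℝ (Fin n))) :=
  (IsGaussian.integrable_id (μ := stdGaussian (EuclideanSpace ℝ (Fin n)))).inner_const v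

/-- The real-valued risk of the least squares estimator. -/
def lseMSE (K : Set (EuclideanSpace ℝ (Fin n))) (μ : EuclideanSpace ℝ (Fin n)) : ℝ :=
  ∫ z, ‖lseError K μ z‖ ^ 2 ∂(stdGaussian (EuclideanSpace ℝ (Fin n)))

/-- Half the expected reduction of the squared distance from the data to the least squares fit:
the mean of the supremum over `p ∈ K` of `⟪Z, p - μ⟫ - ‖p - μ‖ ^ 2 / 2`. -/
def lseGain (K : Set (EuclideanSpace ℝ (Fin n))) (μ : EuclideanSpace ℝ (Fin n)) : ℝ :=
  ∫ z, (inner ℝ z (lseError K μ z) - ‖lseError K μ z‖ ^ 2 / 2)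
    ∂(stdGaussian (EuclideanSpace ℝ (Fin n)))

theorem integral_inner_lseError (hcl : IsClosed K) (hcv : Convex ℝ K)
    {μ : EuclideanSpace ℝ (Fin n)} (hμ : μ ∈ K) :
    ∫ z, inner ℝ z (lseError K μ z) ∂(stdGaussian (EuclideanSpace ℝ (Fin n)))
      = lseGain K μ + lseMSE K μ / 2 := by
  rw [lseGain, integral_sub (integrable_inner_lseError hcl hcv hμ)
    ((integrable_norm_sq_lseError hcl hcv hμ).div_const 2), integral_div, lseMSE]
  ring

/-- The integrand is `(‖z‖² - ‖z - u‖²) / 2`. The bound does not depend on `μ`, so the gain has a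
finite supremum on `K`. -/
theorem lseGain_le (hcl : IsClosed K) (hcv : Convex ℝ K)
    {μ : EuclideanSpace ℝ (Fin n)} (hμ : μ ∈ K) :
    lseGain K μ ≤ ∫ z, ‖z‖ ^ 2 / 2 ∂(stdGaussian (EuclideanSpace ℝ (Fin n))) := by
  refine integral_mono ((integrable_inner_lseError hcl hcv hμ).sub
    ((integrable_norm_sq_lseError hcl hcv hμ).div_const 2))
    (integrable_norm_sq_stdGaussian.div_const 2) fun z => ?_
  have := norm_sub_sq_real z (lseError K μ z)
  have h2 := sq_nonneg ‖z - lseError K μ z‖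
  simp only
  linarith

theorem lseRisk_eq_ofReal (hcl : IsClosed K) (hcv : Convex ℝ K)
    {μ : EuclideanSpace ℝ (Fin n)} (hμ : μ ∈ K) :
    lseRisk K μ = ENNReal.ofReal (lseMSE K μ) := by
  rw [lseMSE, ofReal_integral_eq_lintegral_ofReal (integrable_norm_sq_lseError hcl hcv hμ)
    (Filter.Eventually.of_forall fun z => sq_nonneg _)]
  refine lintegral_congr fun z => ?_
  rw [ENNReal.ofReal_pow (norm_nonneg _), ofReal_norm, lseError]

end Integrals

/-! ### The exponential moment bound. -/

section ExponentialMoment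

variable {K : Set (EuclideanSpace ℝ (Fin n))}

theorem inner_sub_le_lseError (hne : K.Nonempty) (hcl : IsClosed K)
    (ν y : EuclideanSpace ℝ (Fin n)) {p : EuclideanSpace ℝ (Fin n)} (hp : p ∈ K) :
    inner ℝ y (p - ν) - ‖p - ν‖ ^ 2 / 2
      ≤ inner ℝ y (lseError K ν y) - ‖lseError K ν y‖ ^ 2 / 2 := by
  have h := (isClosestPoint_euclideanProj hne hcl (y + ν)).2 p hp
  have e1 : y + ν - euclideanProj K (y + ν) = y - lseError K ν y := by
    simp only [lseError]; abel
  have e2 : y + ν - p = y - (p - ν) := by abel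
  rw [e1, e2] at h
  have h' := pow_le_pow_left₀ (norm_nonneg _) h 2
  rw [norm_sub_sq_real, norm_sub_sq_real] at h'
  linarith

/-- An exponential moment bound of Tsirelson–Vitale type. -/
theorem lintegral_exp_lseError_le (hcl : IsClosed K) (hcv : Convex ℝ K)
    (μ : EuclideanSpace ℝ (Fin n)) {ν : EuclideanSpace ℝ (Fin n)} (hν : ν ∈ K)
    {s : ℝ} (hs : 0 ≤ s) :
    ∫⁻ z, ENNReal.ofReal (Real.exp (s * inner ℝ z (lseError K μ z) - s ^ 2 * ‖lseError K μ z‖ ^ 2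
        - s / 2 * ‖lseError K μ z + μ - ν‖ ^ 2)) ∂(stdGaussian (EuclideanSpace ℝ (Fin n)))
      ≤ ENNReal.ofReal (Real.exp (s * lseGain K ν)) := by
  have hne : K.Nonempty := ⟨ν, hν⟩
  have cμ := continuous_lseError hne hcl hcv μ
  have cν := continuous_lseError hne hcl hcv ν
  -- The linear term recentres the maximum from `ν` to `μ`; having mean zero, it leaves the
  -- expectation `lseGain K ν`.
  set F : EuclideanSpace ℝ (Fin n) → ℝ := fun y =>
    inner ℝ y (ν - μ) + (inner ℝ y (lseError K ν y) - ‖lseError K ν y‖ ^ 2 / 2) with hF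
  have i1 := integrable_inner_const_stdGaussian (ν - μ)
  have i2 : Integrable (fun y => inner ℝ y (lseError K ν y) - ‖lseError K ν y‖ ^ 2 / 2)
      (stdGaussian (EuclideanSpace ℝ (Fin n))) := (integrable_inner_lseError hcl hcv hν).sub
    ((integrable_norm_sq_lseError hcl hcv hν).div_const 2)
  have hFi : Integrable F (stdGaussian (EuclideanSpace ℝ (Fin n))) := i1.add i2
  have hFe : ∫ y, F y ∂(stdGaussian (EuclideanSpace ℝ (Fin n))) = lseGain K ν := by
    rw [hF, integral_add i1 i2, integral_inner_const_stdGaussian, zero_add]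
    rfl
  have hb : ENNReal.ofReal (Real.exp (-(s * lseGain K ν)))
      ≤ ∫⁻ y, ENNReal.ofReal (Real.exp (-(s * F y)))
          ∂(stdGaussian (EuclideanSpace ℝ (Fin n))) := by
    have := ofReal_exp_integral_le_lintegral (hFi.const_mul (-s))
    rw [integral_const_mul, hFe] at this
    simpa [neg_mul] using this
  have tau := propertyTau_stdGaussian (n := n)
    (fun z => ENNReal.ofReal (Real.exp (s * inner ℝ z (lseError K μ z)
      - s ^ 2 * ‖lseError K μ z‖ ^ 2 - s / 2 * ‖lseError K μ z + μ - ν‖ ^ 2)))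
    (fun y => ENNReal.ofReal (Real.exp (-(s * F y)))) (by fun_prop) (by fun_prop) (by
      intro x y
      rw [← ENNReal.ofReal_mul (Real.exp_pos _).le, ← Real.exp_add]
      refine ENNReal.ofReal_le_ofReal (Real.exp_le_exp.2 ?_)
      have h1 := mul_le_mul_of_nonneg_left
        (inner_sub_le_lseError hne hcl ν y (lseError_add_mem hne hcl μ x)) hs
      have h2 : inner ℝ y (lseError K μ x + μ - ν) + inner ℝ y (ν - μ)
          = inner ℝ y (lseError K μ x) := by
        rw [← inner_add_right]; congr 1; abel
      -- Testing the maximum in `F y` at `p = μ + u(x)` leaves `s ⟪x - y, u(x)⟫ - s² ‖u(x)‖²`, which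
      -- this square bounds by the cost `‖x - y‖² / 4`.
      have h3 := sq_nonneg ‖(1 / 2 : ℝ) • (x - y) - s • lseError K μ x‖
      rw [norm_sub_sq_real, norm_smul, norm_smul, real_inner_smul_left, real_inner_smul_right,
        inner_sub_left, mul_pow, mul_pow, Real.norm_eq_abs, Real.norm_eq_abs, sq_abs, sq_abs] at h3
      simp only [hF]
      have h4 : s * inner ℝ y (ν - μ) = s * inner ℝ y (lseError K μ x)
          - s * inner ℝ y (lseError K μ x + μ - ν) := by
        rw [← h2]; ring
      nlinarith [h1, h3, h4])
  set A := ∫⁻ z, ENNReal.ofReal (Real.exp (s * inner ℝ z (lseError K μ z)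
    - s ^ 2 * ‖lseError K μ z‖ ^ 2 - s / 2 * ‖lseError K μ z + μ - ν‖ ^ 2))
    ∂(stdGaussian (EuclideanSpace ℝ (Fin n)))
  have h5 := (mul_le_mul_right hb A).trans tau
  calc A = A * ENNReal.ofReal (Real.exp (-(s * lseGain K ν)))
        * ENNReal.ofReal (Real.exp (s * lseGain K ν)) := by
        rw [mul_assoc, ← ENNReal.ofReal_mul (Real.exp_pos _).le, ← Real.exp_add]
        simp
    _ ≤ 1 * ENNReal.ofReal (Real.exp (s * lseGain K ν)) := mul_le_mul_left h5 _
    _ = _ := one_mul _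

end ExponentialMoment

/-! ### A uniform positive lower bound for the least squares risk. -/

section LowerBound

theorem stdGaussian_ball_eq (v : EuclideanSpace ℝ (Fin n)) (ρ : ℝ) :
    stdGaussian (EuclideanSpace ℝ (Fin n)) (Metric.ball v ρ)
      = ∫⁻ z in Metric.ball 0 ρ, ENNReal.ofReal (Real.exp (-inner ℝ z v - ‖v‖ ^ 2 / 2))
          ∂(stdGaussian (EuclideanSpace ℝ (Fin n))) := by
  rw [← lintegral_indicator_one measurableSet_ball, ← lintegral_add_mul_exp_stdGaussian
    (measurable_one.indicator measurableSet_ball) v, ← lintegral_indicator measurableSet_ball]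
  refine lintegral_congr fun z => ?_
  by_cases hz : z ∈ Metric.ball 0 ρ
  · have : z + v ∈ Metric.ball v ρ := by simpa [dist_eq_norm] using hz
    simp [Set.indicator_of_mem hz, Set.indicator_of_mem this]
  · have : z + v ∉ Metric.ball v ρ := by simpa [dist_eq_norm] using hz
    simp [Set.indicator_of_notMem hz, Set.indicator_of_notMem this]

/-- If this ball were null, Cameron–Martin would make every ball of the same radius null, hence the
whole space. -/
theorem stdGaussian_ball_zero_ne_zero {ρ : ℝ} (hρ : 0 < ρ) :
    stdGaussian (EuclideanSpace ℝ (Fin n)) (Metric.ball 0 ρ) ≠ 0 := by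
  intro h
  have : stdGaussian (EuclideanSpace ℝ (Fin n)) Set.univ = 0 :=
    measure_null_of_locally_null _ fun v _ =>
      ⟨Metric.ball v ρ, mem_nhdsWithin_of_mem_nhds (Metric.ball_mem_nhds v hρ), by
        rw [stdGaussian_ball_eq, Measure.restrict_eq_zero.2 h, lintegral_zero_measure]⟩
  simp at this

theorem exp_mul_stdGaussian_ball_zero_le (v : EuclideanSpace ℝ (Fin n)) (ρ : ℝ) :
    ENNReal.ofReal (Real.exp (-(ρ * ‖v‖) - ‖v‖ ^ 2 / 2))
        * stdGaussian (EuclideanSpace ℝ (Fin n)) (Metric.ball 0 ρ)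
      ≤ stdGaussian (EuclideanSpace ℝ (Fin n)) (Metric.ball v ρ) := by
  rw [stdGaussian_ball_eq v, ← setLIntegral_const]
  refine setLIntegral_mono (by fun_prop) fun z hz => ?_
  refine ENNReal.ofReal_le_ofReal (Real.exp_le_exp.2 ?_)
  have h1 : ‖z‖ ≤ ρ := (mem_ball_zero_iff.1 hz).le
  have h2 := real_inner_le_norm z v
  nlinarith [mul_le_mul_of_nonneg_right h1 (norm_nonneg v)]

variable {K : Set (EuclideanSpace ℝ (Fin n))}

/-- One of `a`, `b` is at distance at least `‖a - b‖ / 2` from `μ`; move from `μ` towards it. -/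
theorem exists_norm_eq_add_mem (hcv : Convex ℝ K) {a b μ : EuclideanSpace ℝ (Fin n)} (ha : a ∈ K)
    (hb : b ∈ K) (hab : a ≠ b) (hμ : μ ∈ K) : ∃ v, ‖v‖ = ‖a - b‖ / 2 ∧ v + μ ∈ K := by
  have hpos : 0 < ‖a - b‖ := norm_pos_iff.2 (sub_ne_zero.2 hab)
  obtain ⟨q, hq, hqn⟩ : ∃ q ∈ K, ‖a - b‖ / 2 ≤ ‖q - μ‖ := by
    by_contra! h
    have h1 := h a ha
    have h2 := h b hb
    have h3 := norm_sub_le_norm_sub_add_norm_sub a μ b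
    rw [norm_sub_rev μ b] at h3
    linarith
  have hq0 : 0 < ‖q - μ‖ := by linarith
  refine ⟨(‖a - b‖ / 2 / ‖q - μ‖) • (q - μ), ?_, ?_⟩
  · rw [norm_smul, Real.norm_of_nonneg (by positivity), div_mul_cancel₀ _ hq0.ne']
  · have := hcv.add_smul_sub_mem hμ hq (t := ‖a - b‖ / 2 / ‖q - μ‖)
      ⟨by positivity, (div_le_one hq0).2 hqn⟩
    rwa [add_comm]

/-- The error map fixes some `v` of norm `τ` and is `1`-Lipschitz, so it has norm at least `τ / 2`
on the ball of radius `τ / 2` about `v`. The Gaussian mass of that ball is bounded below in terms of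
`τ` alone (for fixed `n`), uniformly in `μ`. -/
theorem exists_pos_le_lseMSE (hcl : IsClosed K) (hcv : Convex ℝ K)
    (hK : K.Nontrivial) : ∃ c > 0, ∀ μ ∈ K, c ≤ lseMSE K μ := by
  obtain ⟨a, ha, b, hb, hab⟩ := hK
  set τ := ‖a - b‖ / 2 with hτ
  have hτ0 : 0 < τ := half_pos (norm_pos_iff.2 (sub_ne_zero.2 hab))
  set e := ENNReal.ofReal ((τ / 2) ^ 2) * (ENNReal.ofReal (Real.exp (-(τ / 2 * τ) - τ ^ 2 / 2))
    * stdGaussian (EuclideanSpace ℝ (Fin n)) (Metric.ball 0 (τ / 2))) with he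
  have he0 : e ≠ 0 := by
    refine mul_ne_zero (by simpa using by positivity) (mul_ne_zero ?_ ?_)
    · simpa using Real.exp_pos _
    · exact stdGaussian_ball_zero_ne_zero (half_pos hτ0)
  have het : e ≠ ∞ := ENNReal.mul_ne_top ENNReal.ofReal_ne_top
    (ENNReal.mul_ne_top ENNReal.ofReal_ne_top (measure_ne_top _ _))
  refine ⟨e.toReal, ENNReal.toReal_pos he0 het, fun μ hμ => ?_⟩
  have hne : K.Nonempty := ⟨μ, hμ⟩
  have hR : 0 ≤ lseMSE K μ := integral_nonneg fun z => sq_nonneg _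
  refine ENNReal.toReal_le_of_le_ofReal hR ?_
  obtain ⟨v, hv, hvK⟩ := exists_norm_eq_add_mem hcv ha hb hab hμ
  rw [← hτ] at hv
  have h1 := exp_mul_stdGaussian_ball_zero_le v (τ / 2)
  rw [hv] at h1
  rw [he, lseMSE, ofReal_integral_eq_lintegral_ofReal (integrable_norm_sq_lseError hcl hcv hμ)
    (Filter.Eventually.of_forall fun z => sq_nonneg _)]
  refine (mul_le_mul_right h1 _).trans ?_
  rw [← setLIntegral_const]
  refine (setLIntegral_mono' measurableSet_ball fun z hz => ?_).trans
    (setLIntegral_le_lintegral _ _)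
  refine ENNReal.ofReal_le_ofReal (pow_le_pow_left₀ (half_pos hτ0).le ?_ 2)
  have h2 := norm_lseError_sub_le hne hcl hcv μ z v
  rw [lseError_eq_self hcl hcv hvK] at h2
  have h3 : ‖z - v‖ < τ / 2 := by rw [← dist_eq_norm]; exact hz
  have h4 := norm_sub_norm_le v (lseError K μ z)
  rw [norm_sub_rev, hv] at h4
  linarith

end LowerBound

/-! ### The Bayesian inequality. -/

section Bayes

variable {K : Set (EuclideanSpace ℝ (Fin n))}

theorem integrable_inner_snd_lseError_fst (hcl : IsClosed K) (hcv : Convex ℝ K)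
    {μ : EuclideanSpace ℝ (Fin n)} (hμ : μ ∈ K) :
    Integrable (fun p : EuclideanSpace ℝ (Fin n) × EuclideanSpace ℝ (Fin n) =>
        inner ℝ p.2 (lseError K μ p.1))
      ((stdGaussian (EuclideanSpace ℝ (Fin n))).prod (stdGaussian _)) := by
  have := continuous_lseError ⟨μ, hμ⟩ hcl hcv μ
  refine ((integrable_norm_sq_stdGaussian.comp_fst (stdGaussian _)).add
    (integrable_norm_sq_stdGaussian.comp_snd (stdGaussian _))).mono
    (by fun_prop) (Filter.Eventually.of_forall fun p => ?_)
  have h1 := (abs_real_inner_le_norm p.2 (lseError K μ p.1)).trans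
    (mul_le_mul_of_nonneg_left (norm_lseError_le hcl hcv hμ p.1) (norm_nonneg _))
  rw [Real.norm_eq_abs]
  refine h1.trans (le_trans ?_ (le_abs_self _))
  rw [Pi.add_apply]
  nlinarith [sq_nonneg (‖p.1‖ - ‖p.2‖), sq_nonneg (‖p.1‖), sq_nonneg (‖p.2‖)]

theorem integral_inner_snd_lseError_fst (hcl : IsClosed K) (hcv : Convex ℝ K)
    {μ : EuclideanSpace ℝ (Fin n)} (hμ : μ ∈ K) :
    ∫ p : EuclideanSpace ℝ (Fin n) × EuclideanSpace ℝ (Fin n), inner ℝ p.2 (lseError K μ p.1)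
      ∂((stdGaussian (EuclideanSpace ℝ (Fin n))).prod (stdGaussian _)) = 0 := by
  rw [integral_prod _ (integrable_inner_snd_lseError_fst hcl hcv hμ)]
  simp [integral_inner_const_stdGaussian]

/-- The Cameron–Martin formula for a random translation, independent of the noise. -/
theorem lintegral_prod_add_mul_exp_stdGaussian
    {F : EuclideanSpace ℝ (Fin n) × EuclideanSpace ℝ (Fin n) → ℝ≥0∞} (hF : Measurable F)
    {v : EuclideanSpace ℝ (Fin n) → EuclideanSpace ℝ (Fin n)} (hv : Measurable v) :
    ∫⁻ p : EuclideanSpace ℝ (Fin n) × EuclideanSpace ℝ (Fin n), F (p.1, p.2 + v p.1)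
        * ENNReal.ofReal (Real.exp (-inner ℝ p.2 (v p.1) - ‖v p.1‖ ^ 2 / 2))
        ∂((stdGaussian (EuclideanSpace ℝ (Fin n))).prod (stdGaussian _))
      = ∫⁻ x, ∫⁻ w, F (w, x) ∂(stdGaussian (EuclideanSpace ℝ (Fin n)))
          ∂(stdGaussian (EuclideanSpace ℝ (Fin n))) := by
  rw [lintegral_prod _ (by fun_prop),
    lintegral_lintegral_swap (f := fun x w => F (w, x)) (by fun_prop)]
  exact lintegral_congr fun w => lintegral_add_mul_exp_stdGaussian
    (f := fun x => F (w, x)) (by fun_prop) (v w)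

/-- The last bracket in the exponent is the Cameron–Martin weight of the shift by `r u(W)`. It makes
the data `x` independent of `W`, so for each `x` the moment bound applies with `ν = f x`. -/
theorem lintegral_exp_prior_le_one (hcl : IsClosed K) (hcv : Convex ℝ K)
    {μ : EuclideanSpace ℝ (Fin n)} (hμ : μ ∈ K) {s : ℝ} (hs : 0 ≤ s) (r : ℝ)
    {f : EuclideanSpace ℝ (Fin n) → EuclideanSpace ℝ (Fin n)} (hf : Measurable f)
    (hfK : ∀ x, f x ∈ K) {h₀ : ℝ} (hh₀ : ∀ ν ∈ K, lseGain K ν ≤ h₀) :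
    ∫⁻ p : EuclideanSpace ℝ (Fin n) × EuclideanSpace ℝ (Fin n),
        ENNReal.ofReal (Real.exp (s * inner ℝ p.1 (lseError K μ p.1)
          - s ^ 2 * ‖lseError K μ p.1‖ ^ 2
          - s / 2 * ‖lseError K μ p.1 + μ - f (p.2 + r • lseError K μ p.1)‖ ^ 2 - s * h₀
          - (r * inner ℝ p.2 (lseError K μ p.1) + r ^ 2 / 2 * ‖lseError K μ p.1‖ ^ 2)))
      ∂((stdGaussian (EuclideanSpace ℝ (Fin n))).prod (stdGaussian _)) ≤ 1 := by
  have mu := (continuous_lseError ⟨μ, hμ⟩ hcl hcv μ).measurable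
  have mF : Measurable fun p : EuclideanSpace ℝ (Fin n) × EuclideanSpace ℝ (Fin n) =>
      ENNReal.ofReal (Real.exp (s * inner ℝ p.1 (lseError K μ p.1)
        - s ^ 2 * ‖lseError K μ p.1‖ ^ 2 - s / 2 * ‖lseError K μ p.1 + μ - f p.2‖ ^ 2))
      * ENNReal.ofReal (Real.exp (-(s * h₀))) := by fun_prop
  have shift := lintegral_prod_add_mul_exp_stdGaussian mF (mu.const_smul r)
  calc _ = _ := lintegral_congr fun p => ?_
    _ = _ := shift
    _ ≤ ∫⁻ _, 1 ∂(stdGaussian (EuclideanSpace ℝ (Fin n))) := lintegral_mono fun x => ?_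
    _ = 1 := by simp
  · rw [← ENNReal.ofReal_mul (Real.exp_pos _).le, ← Real.exp_add,
      ← ENNReal.ofReal_mul (Real.exp_pos _).le, ← Real.exp_add, Pi.smul_apply,
      real_inner_smul_right, norm_smul, mul_pow, Real.norm_eq_abs, sq_abs]
    congr 2
    ring
  · rw [lintegral_mul_const' _ _ ENNReal.ofReal_ne_top]
    refine (mul_le_mul_left (lintegral_exp_lseError_le hcl hcv μ (hfK x) hs) _).trans ?_
    rw [← ENNReal.ofReal_mul (Real.exp_pos _).le, ← Real.exp_add, ENNReal.ofReal_le_one,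
      Real.exp_le_one_iff]
    have := mul_le_mul_of_nonneg_left (hh₀ (f x) (hfK x)) hs
    linarith

/-- When the mean is `μ + r • lseError K μ W` with `W` standard Gaussian, and `Z` is the noise, no
`K`-valued function of the data (centred at `μ`) is close to `μ + lseError K μ W`, unless the gain
at `μ` falls short of its supremum over `K`. -/
theorem lseGain_add_lseMSE_le_of_prior (hcl : IsClosed K) (hcv : Convex ℝ K)
    {μ : EuclideanSpace ℝ (Fin n)} (hμ : μ ∈ K) {s : ℝ} (hs : 0 ≤ s) (r : ℝ)
    {f : EuclideanSpace ℝ (Fin n) → EuclideanSpace ℝ (Fin n)} (hf : Measurable f)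
    (hfK : ∀ x, f x ∈ K) {h₀ : ℝ} (hh₀ : ∀ ν ∈ K, lseGain K ν ≤ h₀)
    (hJ : Integrable (fun p : EuclideanSpace ℝ (Fin n) × EuclideanSpace ℝ (Fin n) =>
        ‖lseError K μ p.1 + μ - f (p.2 + r • lseError K μ p.1)‖ ^ 2)
      ((stdGaussian (EuclideanSpace ℝ (Fin n))).prod (stdGaussian _))) :
    s * (lseGain K μ + lseMSE K μ / 2) ≤ s ^ 2 * lseMSE K μ
      + s / 2 * (∫ p : EuclideanSpace ℝ (Fin n) × EuclideanSpace ℝ (Fin n),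
          ‖lseError K μ p.1 + μ - f (p.2 + r • lseError K μ p.1)‖ ^ 2
          ∂((stdGaussian (EuclideanSpace ℝ (Fin n))).prod (stdGaussian _)))
      + s * h₀ + r ^ 2 / 2 * lseMSE K μ := by
  have ia := ((integrable_inner_lseError hcl hcv hμ).comp_fst
    (stdGaussian (EuclideanSpace ℝ (Fin n)))).const_mul s
  have hn := (integrable_norm_sq_lseError hcl hcv hμ).comp_fst
    (stdGaussian (EuclideanSpace ℝ (Fin n)))
  have ib := hn.const_mul (s ^ 2)
  have ic := hJ.const_mul (s / 2)
  have ie := (integrable_inner_snd_lseError_fst hcl hcv hμ).const_mul r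
  have ig := hn.const_mul (r ^ 2 / 2)
  have iab := ia.sub ib
  have iabc := iab.sub ic
  have iabcd := iabc.sub (integrable_const (s * h₀))
  have ieg := ie.add ig
  -- By Jensen the exponent has mean at most zero. Its cross term `⟪Z, u(W)⟫` vanishes in mean by
  -- independence.
  have main := integral_nonpos_of_lintegral_exp_le_one (iabcd.sub ieg)
    (lintegral_exp_prior_le_one hcl hcv hμ hs r hf hfK hh₀)
  have t0 : ∫ p : EuclideanSpace ℝ (Fin n) × EuclideanSpace ℝ (Fin n),
      inner ℝ p.1 (lseError K μ p.1) ∂((stdGaussian _).prod (stdGaussian _))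
        = lseGain K μ + lseMSE K μ / 2 := by
    rw [← integral_inner_lseError hcl hcv hμ,
      integral_fun_fst (fun w => inner ℝ w (lseError K μ w))]
    simp
  have t1 : ∫ p : EuclideanSpace ℝ (Fin n) × EuclideanSpace ℝ (Fin n),
      ‖lseError K μ p.1‖ ^ 2 ∂((stdGaussian _).prod (stdGaussian _)) = lseMSE K μ := by
    rw [lseMSE, integral_fun_fst (fun w => ‖lseError K μ w‖ ^ 2)]
    simp
  rw [integral_sub' iabcd ieg, integral_sub' iabc (integrable_const _), integral_sub' iab ic,
    integral_sub' ia ib, integral_add' ie ig] at main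
  simp only [integral_const_mul, t0, t1, integral_inner_snd_lseError_fst hcl hcv hμ,
    integral_const, probReal_univ, one_smul, mul_zero, zero_add] at main
  linarith

end Bayes

/-! ### The contradiction and the universal constant. -/

variable {K : Set (EuclideanSpace ℝ (Fin n))}

theorem exists_forall_lseGain_le_add (hne : K.Nonempty) (hcl : IsClosed K) (hcv : Convex ℝ K)
    {c : ℝ} (hc : 0 < c) : ∃ μ ∈ K, ∀ ν ∈ K, lseGain K ν ≤ lseGain K μ + c := by
  have hbdd : BddAbove (lseGain K '' K) :=
    ⟨_, Set.forall_mem_image.2 fun μ hμ => lseGain_le hcl hcv hμ⟩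
  obtain ⟨_, ⟨μ, hμ, rfl⟩, h⟩ :=
    exists_lt_of_lt_csSup (hne.image (lseGain K)) (sub_lt_self (sSup (lseGain K '' K)) hc)
  refine ⟨μ, hμ, fun ν hν => ?_⟩
  have := le_csSup hbdd (Set.mem_image_of_mem _ hν)
  linarith

/-- The error is `1`-Lipschitz in the centre. This controls the least squares risk at the random
mean `μ + r u(W)` by that at `μ`. -/
theorem lseMSE_le (hcl : IsClosed K) (hcv : Convex ℝ K) {μ θ : EuclideanSpace ℝ (Fin n)}
    (hμ : μ ∈ K) (hθ : θ ∈ K) : lseMSE K θ ≤ 2 * lseMSE K μ + 2 * ‖θ - μ‖ ^ 2 := by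
  have hi := (integrable_norm_sq_lseError hcl hcv hμ).const_mul 2
  have e : 2 * lseMSE K μ + 2 * ‖θ - μ‖ ^ 2 = ∫ z, (2 * ‖lseError K μ z‖ ^ 2 + 2 * ‖θ - μ‖ ^ 2)
      ∂(stdGaussian (EuclideanSpace ℝ (Fin n))) := by
    rw [integral_add hi (integrable_const _), integral_const_mul, lseMSE]
    simp
  rw [e]
  refine integral_mono (integrable_norm_sq_lseError hcl hcv hθ) (hi.add (integrable_const _))
    fun z => ?_
  have h1 := norm_lseError_sub_lseError_le ⟨μ, hμ⟩ hcl hcv θ μ z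
  have h2 := norm_sub_norm_le (lseError K θ z) (lseError K μ z)
  have h3 : ‖lseError K θ z‖ ^ 2 ≤ (‖lseError K μ z‖ + ‖θ - μ‖) ^ 2 :=
    pow_le_pow_left₀ (norm_nonneg _) (by linarith) 2
  simp only
  nlinarith [sq_nonneg (‖lseError K μ z‖ - ‖θ - μ‖)]

/-- Dilation about `μ` by `1/r` sends `μ + r u` to `μ + u`, a point of `K`; projecting afterwards
cannot increase the distance to it. -/
theorem norm_sub_euclideanProj_smul_le (hcl : IsClosed K) (hcv : Convex ℝ K)
    {μ u y : EuclideanSpace ℝ (Fin n)} (hu : u + μ ∈ K) {r : ℝ} (hr : 0 < r) :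
    ‖u + μ - euclideanProj K (μ + r⁻¹ • (y - μ))‖ ≤ r⁻¹ * ‖y - (μ + r • u)‖ := by
  have h := norm_euclideanProj_sub_le ⟨_, hu⟩ hcl hcv (u + μ) (μ + r⁻¹ • (y - μ))
  rw [euclideanProj_eq_self hcl hcv hu] at h
  refine h.trans_eq ?_
  have e : u + μ - (μ + r⁻¹ • (y - μ)) = -(r⁻¹ • (y - (μ + r • u))) := by
    have : r⁻¹ • r • u = u := inv_smul_smul₀ hr.ne' u
    rw [← sub_sub y μ, smul_sub _ (y - μ), this]
    abel
  rw [e, norm_neg, norm_smul, Real.norm_of_nonneg (inv_nonneg.2 hr.le)]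

/-- The Bayes risk of an estimator whose risk on `K` is at most a small multiple of that of the
least squares estimator. -/
theorem lintegral_norm_sq_sub_euclideanProj_le (hcl : IsClosed K) (hcv : Convex ℝ K)
    {μ : EuclideanSpace ℝ (Fin n)} (hμ : μ ∈ K)
    {g : EuclideanSpace ℝ (Fin n) → EuclideanSpace ℝ (Fin n)} (hg : Measurable g)
    {C r : ℝ} (hC : 0 ≤ C) (hr : 0 < r) (hr1 : r ≤ 1)
    (h : ∀ θ ∈ K, risk g θ ≤ ENNReal.ofReal C * lseRisk K θ) :
    ∫⁻ p : EuclideanSpace ℝ (Fin n) × EuclideanSpace ℝ (Fin n),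
        ENNReal.ofReal (‖lseError K μ p.1 + μ
          - euclideanProj K (μ + r⁻¹ • (g (p.2 + r • lseError K μ p.1 + μ) - μ))‖ ^ 2)
        ∂((stdGaussian (EuclideanSpace ℝ (Fin n))).prod (stdGaussian _))
      ≤ ENNReal.ofReal (r⁻¹ ^ 2 * C * (2 + 2 * r ^ 2) * lseMSE K μ) := by
  have hne : K.Nonempty := ⟨μ, hμ⟩
  have mu := (continuous_lseError hne hcl hcv μ).measurable
  have mP := (continuous_euclideanProj hne hcl hcv).measurable
  have hθ : ∀ w, μ + r • lseError K μ w ∈ K := by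
    intro w
    have := hcv.add_smul_sub_mem hμ (lseError_add_mem hne hcl μ w) (t := r) ⟨hr.le, hr1⟩
    rwa [add_sub_cancel_right] at this
  have hi := ((integrable_norm_sq_lseError hcl hcv hμ).const_mul (2 * r ^ 2)).add
    (integrable_const (2 * lseMSE K μ))
  have hint := hi.const_mul (r⁻¹ ^ 2 * C)
  rw [lintegral_prod _ (by fun_prop)]
  calc _ ≤ ∫⁻ w, ENNReal.ofReal (r⁻¹ ^ 2 * C
          * (2 * r ^ 2 * ‖lseError K μ w‖ ^ 2 + 2 * lseMSE K μ)) ∂(stdGaussian _) := by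
        refine lintegral_mono fun w => ?_
        have h1 : ∫⁻ z, ENNReal.ofReal (‖lseError K μ w + μ
              - euclideanProj K (μ + r⁻¹ • (g (z + r • lseError K μ w + μ) - μ))‖ ^ 2)
              ∂(stdGaussian _)
            ≤ ENNReal.ofReal (r⁻¹ ^ 2) * risk g (μ + r • lseError K μ w) := by
          rw [risk, ← lintegral_const_mul' _ _ ENNReal.ofReal_ne_top]
          refine lintegral_mono fun z => ?_
          have h2 := norm_sub_euclideanProj_smul_le hcl hcv (lseError_add_mem hne hcl μ w)
            (y := g (z + r • lseError K μ w + μ)) hr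
          rw [← ofReal_norm, ← ENNReal.ofReal_pow (norm_nonneg _),
            ← ENNReal.ofReal_mul (by positivity), ← mul_pow, add_comm μ (r • lseError K μ w),
            ← add_assoc]
          rw [add_comm μ (r • lseError K μ w)] at h2
          exact ENNReal.ofReal_le_ofReal (pow_le_pow_left₀ (norm_nonneg _) h2 2)
        refine h1.trans ((mul_le_mul_right (h _ (hθ w)) _).trans ?_)
        rw [lseRisk_eq_ofReal hcl hcv (hθ w), ← ENNReal.ofReal_mul hC,
          ← ENNReal.ofReal_mul (by positivity), ← mul_assoc]
        refine ENNReal.ofReal_le_ofReal (mul_le_mul_of_nonneg_left ?_ (by positivity))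
        have h3 := lseMSE_le hcl hcv hμ (hθ w)
        rw [add_sub_cancel_left, norm_smul, mul_pow, Real.norm_eq_abs, sq_abs] at h3
        linarith
    _ = ENNReal.ofReal (∫ w, r⁻¹ ^ 2 * C
          * (2 * r ^ 2 * ‖lseError K μ w‖ ^ 2 + 2 * lseMSE K μ) ∂(stdGaussian _)) := by
        have hR : 0 ≤ lseMSE K μ := integral_nonneg fun z => sq_nonneg _
        exact (ofReal_integral_eq_lintegral_ofReal hint
          (Filter.Eventually.of_forall fun w => by
            simp only [Pi.add_apply, Pi.zero_apply]; positivity)).symm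
    _ = _ := by
        rw [integral_const_mul, integral_add
          ((integrable_norm_sq_lseError hcl hcv hμ).const_mul (2 * r ^ 2)) (integrable_const _),
          integral_const_mul, ← lseMSE]
        congr 1
        simp
        ring

theorem exists_lseRisk_le_risk_of_nontrivial (hK : K.Nontrivial) (hcl : IsClosed K)
    (hcv : Convex ℝ K) {g : EuclideanSpace ℝ (Fin n) → EuclideanSpace ℝ (Fin n)}
    (hg : Measurable g) : ∃ μ ∈ K, ENNReal.ofReal (1 / 2048) * lseRisk K μ ≤ risk g μ := by
  by_contra! hcon
  obtain ⟨c, hc0, hc⟩ := exists_pos_le_lseMSE hcl hcv hK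
  -- The supremum of the gain need not be attained. The uniform lower bound `c` allows a slack `c /
  -- 8`, at most one eighth of the risk at whichever `μ` results.
  obtain ⟨μ, hμ, hmax⟩ := exists_forall_lseGain_le_add hK.nonempty hcl hcv
    (c := c / 8) (by positivity)
  have hne : K.Nonempty := ⟨μ, hμ⟩
  have mu := (continuous_lseError hne hcl hcv μ).measurable
  have mP := (continuous_euclideanProj hne hcl hcv).measurable
  have hR := hc μ hμ
  have hL := lintegral_norm_sq_sub_euclideanProj_le hcl hcv hμ hg (C := 1 / 2048) (r := 1 / 8)
    (by norm_num) (by norm_num) (by norm_num) fun θ hθ => (hcon θ hθ).le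
  set f : EuclideanSpace ℝ (Fin n) → EuclideanSpace ℝ (Fin n) := fun x =>
    euclideanProj K (μ + (1 / 8 : ℝ)⁻¹ • (g (x + μ) - μ)) with hf
  have mf : Measurable f := by fun_prop
  have hJ : Integrable (fun p : EuclideanSpace ℝ (Fin n) × EuclideanSpace ℝ (Fin n) =>
        ‖lseError K μ p.1 + μ - f (p.2 + (1 / 8 : ℝ) • lseError K μ p.1)‖ ^ 2)
      ((stdGaussian (EuclideanSpace ℝ (Fin n))).prod (stdGaussian _)) := by
    refine ⟨by fun_prop, ?_⟩
    rw [hasFiniteIntegral_iff_ofReal (Filter.Eventually.of_forall fun p => sq_nonneg _)]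
    exact hL.trans_lt ENNReal.ofReal_lt_top
  have hJle := (ENNReal.ofReal_le_ofReal_iff
    (mul_nonneg (by norm_num) (hc0.le.trans hR))).1
    ((ofReal_integral_eq_lintegral_ofReal hJ
      (Filter.Eventually.of_forall fun p => sq_nonneg _)).trans_le hL)
  -- With `s = r = 1/8` and `J` the Bayes error of `f`, the gain at `μ` cancels and leaves `R/16 ≤
  -- R/64 + J/16 + c/64 + R/128`. Since `c ≤ R` and `J ≤ 64 (1/2048) (2 + 1/32) R = 65 R / 1024`,
  -- this contradicts `R > 0`.
  have key := lseGain_add_lseMSE_le_of_prior hcl hcv hμ (s := 1 / 8) (by norm_num) (1 / 8) mf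
    (fun x => euclideanProj_mem hne hcl _) hmax hJ
  norm_num at hJle key
  linarith

theorem isAdmissibilityConstant_one_div : IsAdmissibilityConstant (1 / 2048) := by
  intro n K hne hcl hcv g hg
  -- On a single point the projection is constant and the least squares risk is zero.
  rcases K.subsingleton_or_nontrivial with hK | hK
  · obtain ⟨μ, hμ⟩ := hne
    have : ∀ z, euclideanProj K (z + μ) = μ := fun z => hK (euclideanProj_mem ⟨μ, hμ⟩ hcl _) hμ
    exact ⟨μ, hμ, by simp [lseRisk, risk, this]⟩
  · exact exists_lseRisk_le_risk_of_nontrivial hK hcl hcv hg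

end

theorem proposition1p6 :
    ∃ C : ℝ, 0 < C ∧ IsAdmissibilityConstant C ∧
      ∀ (n : ℕ) (K : Set (EuclideanSpace ℝ (Fin n))), K.Nonempty → IsClosed K → Convex ℝ K →
        ∀ g : EuclideanSpace ℝ (Fin n) → EuclideanSpace ℝ (Fin n), Measurable g →
          ENNReal.ofReal C * lseRiskRatio K * (⨆ μ ∈ K, lseRisk K μ) ≤ ⨆ μ ∈ K, risk g μ := by
  refine ⟨1 / 2048, by norm_num, isAdmissibilityConstant_one_div, ?_⟩
  intro n K hne hcl hcv g hg
  obtain ⟨μ, hμ, h⟩ := isAdmissibilityConstant_one_div n K hne hcl hcv g hg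
  calc ENNReal.ofReal (1 / 2048) * lseRiskRatio K * (⨆ μ ∈ K, lseRisk K μ)
      ≤ ENNReal.ofReal (1 / 2048) * ⨅ μ ∈ K, lseRisk K μ := by
        -- Only `sup * (inf / sup) ≤ inf` is needed, which also covers `0 / 0 = 0`.
        rw [mul_assoc, lseRiskRatio, mul_comm (_ / _)]
        exact mul_le_mul_right ENNReal.mul_div_le _
    _ ≤ ENNReal.ofReal (1 / 2048) * lseRisk K μ := mul_le_mul_right (iInf₂_le μ hμ) _
    _ ≤ risk g μ := h
    _ ≤ ⨆ μ ∈ K, risk g μ := le_iSup₂ (f := fun μ _ => risk g μ) μ hμ
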